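/- Let $n\ge 1$, let $\Omega\subset\mathbb R^n$ be a bounded domain (non-empty, open, connected), and let $T>0$, $2<p<\infty$ and $\varepsilon>0$. Put $\Omega_T=\Omega\times(0,T)$, $\alpha=\frac{p-2}{p+n}$, $\beta=\frac{n+2}{p+n}$, $$S_\varepsilon=\{x\in\mathbb R^n\setminus\Omega:\operatorname{dist}(x,\partial\Omega)\le\varepsilon\},\qquad \Gamma_\varepsilon=\big(S_\varepsilon\times[-\varepsilon^2,T]\big)\cup\big(\Omega\times[-\varepsilon^2,0]\big),$$ and let $F:\Gamma_\varepsilon\to\mathbb R$ be continuous. A function $u:\Omega_T\cup\Gamma_\varepsilon\to\mathbb R$ satisfies the dynamic programming principle (DPP) with boundary data $F$ if it is Borel measurable, $u=F$ on $\Gamma_\varepsilon$, and for all $(x,t)\in\Omega_T$ $$u(x,t)=\frac{\beta}{|B_\varepsilon(x)|}\int_{B_\varepsilon(x)}u(y,t-\varepsilon^2)\,dy+\alpha\sup_{|\sigma|=1}\frac{u(x+\varepsilon\sigma,t-\varepsilon^2)+u(x-\varepsilon\sigma,t-\varepsilon^2)}{2}.$$ A strategy $S$ is a sequence of Borel functions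 that assign to each history $(t_0,x_0,\dots,x_k)$, $k\ge 0$, a unit vector $\sigma=S(t_0,x_0,\dots,x_k)\in\mathbb R^n$. For a starting point $(x_0,t_0)$, let $\mathbb P_S^{(x_0,t_0)}$ be the probability measure on sequences of states $(x_k,t_k)_{k\ge0}$ started at $(x_0,t_0)$ under which, given $(x_0,t_0),\dots,(x_k,t_k)$, one has $t_{k+1}=t_k-\varepsilon^2$, and $x_{k+1}$ is with probability $\beta$ uniformly distributed on $B_\varepsilon(x_k)$ and with probability $\frac{\alpha}{2}$ each equal to $x_k+\varepsilon\sigma$ or $x_k-\varepsilon\sigma$, where $\sigma=S(t_0,x_0,\dots,x_k)$. Let $\tau$ be the first index $k\ge 0$ with $(x_k,t_k)\in\Gamma_\varepsilon$, and let the value of the game with payoff $F$ be $$u^\varepsilon(x_0,t_0)=\sup_S\mathbb E_S^{(x_0,t_0)}\big[F(x_\tau,t_\tau)\big].$$ If $u_\varepsilon$ satisfies the DPP with boundary data $F$, then $u_\varepsilon=u^\varepsilon$ on $\Omega_T\cup\Gamma_\varepsilon$. -/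

import Mathlib

open MeasureTheory ProbabilityTheory

namespace DominativeGame

noncomputable section

/-- Euclidean space `ℝⁿ`. -/
abbrev E (n : ℕ) : Type := EuclideanSpace ℝ (Fin n)

/-- A state of the game: a position in `ℝⁿ` together with a time. -/
abbrev State (n : ℕ) : Type := E n × ℝ

/-- `α = (p - 2) / (p + n)`. -/
def alpha (n : ℕ) (p : ℝ) : ℝ := (p - 2) / (p + n)

/-- `β = (n + 2) / (p + n)`. -/
def beta (n : ℕ) (p : ℝ) : ℝ := (n + 2) / (p + n)

/-- The space-time cylinder `Ω_T = Ω × (0, T)`. -/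
def cylinder {n : ℕ} (Ω : Set (E n)) (T : ℝ) : Set (State n) :=
  Ω ×ˢ Set.Ioo 0 T

/-- The outer boundary strip `S_ε = {x ∈ ℝⁿ \ Ω : dist(x, ∂Ω) ≤ ε}`. -/
def outerStrip {n : ℕ} (Ω : Set (E n)) (ε : ℝ) : Set (E n) :=
  {x | x ∉ Ω ∧ Metric.infDist x (frontier Ω) ≤ ε}

/-- The parabolic boundary strip `Γ_ε = (S_ε × [-ε², T]) ∪ (Ω × [-ε², 0])`. -/
def boundaryStrip {n : ℕ} (Ω : Set (E n)) (T ε : ℝ) : Set (State n) :=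
  outerStrip Ω ε ×ˢ Set.Icc (-ε ^ 2) T ∪ Ω ×ˢ Set.Icc (-ε ^ 2) 0

/-- The dynamic programming principle in `Ω_T` with boundary data `F` on `Γ_ε`. Only the values of
`u` on `Ω_T ∪ Γ_ε` and those of `F` on `Γ_ε` matter. -/
structure SatisfiesDPP {n : ℕ} (Ω : Set (E n)) (T p ε : ℝ) (F u : State n → ℝ) : Prop where
  borel : Measurable (fun z : ↥(cylinder Ω T ∪ boundaryStrip Ω T ε) => u z)
  interior : ∀ x t, (x, t) ∈ cylinder Ω T →
    u (x, t) = beta n p * (⨍ y in Metric.ball x ε, u (y, t - ε ^ 2))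
      + alpha n p * ⨆ σ : Metric.sphere (0 : E n) 1,
          (u (x + ε • (σ : E n), t - ε ^ 2) + u (x - ε • (σ : E n), t - ε ^ 2)) / 2
  boundary : ∀ z ∈ boundaryStrip Ω T ε, u z = F z

/-- A strategy: Borel functions `S(t₀, x₀, …, x_k)`, one for each `k`, with values in the unit
sphere. -/
structure Strategy (n : ℕ) where
  dir : (k : ℕ) → ℝ × (Finset.Iic k → E n) → Metric.sphere (0 : E n) 1
  measurable_dir : ∀ k, Measurable (dir k)

/-- The direction selected by `S` after the token positions `(x₀, t₀), …, (x_k, t_k)`. -/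
def Strategy.next {n : ℕ} (S : Strategy n) (k : ℕ) (h : Finset.Iic k → State n) : E n :=
  S.dir k ((h ⟨0, Finset.mem_Iic.2 (Nat.zero_le k)⟩).2, fun i => (h i).1)

/-- The law of the next state when the token is at `z = (x, t)` and the direction is `σ`: with
probability `β` uniform on `B_ε(x) × {t - ε²}`, and with probability `α / 2` each of
`(x ± ε σ, t - ε²)`. -/
def stepLaw {n : ℕ} (p ε : ℝ) (z : State n) (σ : E n) : Measure (State n) :=
  ENNReal.ofReal (beta n p) •
      (ProbabilityTheory.cond volume (Metric.ball z.1 ε)).map (fun y => (y, z.2 - ε ^ 2))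
    + ENNReal.ofReal (alpha n p / 2) • Measure.dirac (z.1 + ε • σ, z.2 - ε ^ 2)
    + ENNReal.ofReal (alpha n p / 2) • Measure.dirac (z.1 - ε • σ, z.2 - ε ^ 2)

theorem Strategy.measurable_next {n : ℕ} (S : Strategy n) (k : ℕ) : Measurable (S.next k) := by
  unfold Strategy.next
  refine measurable_subtype_coe.comp ((S.measurable_dir k).comp ?_)
  fun_prop

theorem measurable_stepLaw {n : ℕ} (p ε : ℝ) :
    Measurable (fun q : State n × E n => stepLaw p ε q.1 q.2) := by
  refine Measure.measurable_of_measurable_coe _ fun A hA => ?_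
  have hm : ∀ s : ℝ, Measurable (fun y : E n => (y, s)) := fun s => by fun_prop
  simp only [stepLaw, Measure.add_apply, Measure.smul_apply, smul_eq_mul]
  refine Measurable.add (Measurable.add (Measurable.const_mul ?_ _) (Measurable.const_mul ?_ _))
    (Measurable.const_mul ?_ _)
  · have hset : MeasurableSet {w : (State n × E n) × E n |
        dist w.2 w.1.1.1 < ε ∧ (w.2, w.1.1.2 - ε ^ 2) ∈ A} := by
      have h1 : Measurable (fun w : (State n × E n) × E n => dist w.2 w.1.1.1) := by fun_prop
      refine MeasurableSet.inter (measurableSet_lt h1 measurable_const) ?_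
      exact (show Measurable (fun w : (State n × E n) × E n => (w.2, w.1.1.2 - ε ^ 2)) by
        fun_prop) hA
    have := measurable_measure_prodMk_left (ν := (volume : Measure (E n))) hset
    convert this.const_mul (volume (Metric.ball (0 : E n) ε))⁻¹ using 1
    funext q
    rw [Measure.map_apply (hm _) hA, cond_apply Metric.isOpen_ball.measurableSet,
      Measure.addHaar_ball_center]
    rfl
  · exact (Measure.measurable_coe hA).comp (Measure.measurable_dirac.comp (by fun_prop))
  · exact (Measure.measurable_coe hA).comp (Measure.measurable_dirac.comp (by fun_prop))

theorem isProbabilityMeasure_stepLaw {n : ℕ} {p ε : ℝ} (hp : 2 < p) (hε : 0 < ε)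
    (z : State n) (σ : E n) : IsProbabilityMeasure (stepLaw p ε z σ) := by
  have hn : (0 : ℝ) ≤ n := Nat.cast_nonneg n
  have hpos : 0 < p + n := by linarith
  have ha : 0 ≤ alpha n p / 2 := by unfold alpha; have := sub_pos.2 hp; positivity
  have hb : 0 ≤ beta n p := by unfold beta; positivity
  have : IsProbabilityMeasure (ProbabilityTheory.cond (volume : Measure (E n)) (Metric.ball z.1 ε)) :=
    cond_isProbabilityMeasure_of_finite (Metric.measure_ball_pos _ _ hε).ne'
      measure_ball_lt_top.ne
  have : IsProbabilityMeasure ((ProbabilityTheory.cond (volume : Measure (E n)) (Metric.ball z.1 ε)).map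
      (fun y => (y, z.2 - ε ^ 2))) :=
    Measure.isProbabilityMeasure_map (by fun_prop)
  refine ⟨?_⟩
  simp only [stepLaw, Measure.add_apply, Measure.smul_apply, smul_eq_mul, measure_univ, mul_one]
  rw [← ENNReal.ofReal_add hb ha, ← ENNReal.ofReal_add (by positivity) ha]
  rw [ENNReal.ofReal_eq_one]
  unfold alpha beta
  field_simp
  ring

theorem measurable_last_next {n : ℕ} (S : Strategy n) (k : ℕ) :
    Measurable (fun h : Finset.Iic k → State n =>
      (h ⟨k, Finset.mem_Iic.2 le_rfl⟩, S.next k h)) :=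
  (measurable_pi_apply (⟨k, Finset.mem_Iic.2 le_rfl⟩ : Finset.Iic k)).prodMk
    (S.measurable_next k)

theorem measurable_transition {n : ℕ} (p ε : ℝ) (S : Strategy n) (k : ℕ) :
    Measurable (fun h : Finset.Iic k → State n =>
      stepLaw p ε (h ⟨k, Finset.mem_Iic.2 le_rfl⟩) (S.next k h)) := by
  have h : Measurable ((fun q : State n × E n => stepLaw p ε q.1 q.2) ∘
      (fun h : Finset.Iic k → State n => (h ⟨k, Finset.mem_Iic.2 le_rfl⟩, S.next k h))) :=
    Measurable.comp (measurable_stepLaw p ε) (measurable_last_next S k)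
  exact h

/-- The transition probability `π_S((x₀, t₀), …, (x_k, t_k), ·)`. -/
def transition {n : ℕ} (p ε : ℝ) (S : Strategy n) (k : ℕ) :
    Kernel (Finset.Iic k → State n) (State n) where
  toFun h := stepLaw p ε (h ⟨k, Finset.mem_Iic.2 le_rfl⟩) (S.next k h)
  measurable' := measurable_transition p ε S k

theorem isMarkovKernel_transition {n : ℕ} {p ε : ℝ} (hp : 2 < p) (hε : 0 < ε)
    (S : Strategy n) (k : ℕ) : IsMarkovKernel (transition p ε S k) :=
  ⟨fun _ => isProbabilityMeasure_stepLaw hp hε _ _⟩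

/-- The law `ℙ_S^{z₀}` of the game sequence started at `z₀ = (x₀, t₀)`: the probability measure on
infinite sequences of states generated by the transition probabilities. -/
def gameLaw {n : ℕ} {p ε : ℝ} (hp : 2 < p) (hε : 0 < ε) (S : Strategy n) (z₀ : State n) :
    Measure (ℕ → State n) :=
  haveI := isMarkovKernel_transition hp hε S
  Kernel.traj (X := fun _ => State n) (transition p ε S) 0 (fun _ => z₀)

/-- The first index `τ` at which the game sequence lies in `Γ_ε` (with the convention `0` on the
sequences that never do; for a start in `Ω_T ∪ Γ_ε` they form a null set). -/
def hitIndex {n : ℕ} (Ω : Set (E n)) (T ε : ℝ) (ω : ℕ → State n) : ℕ :=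
  sInf {k | ω k ∈ boundaryStrip Ω T ε}

/-- The expected payoff `𝔼_S^{z₀}[F(x_τ, t_τ)]`. -/
def expectedPayoff {n : ℕ} (Ω : Set (E n)) (T : ℝ) {p ε : ℝ} (hp : 2 < p) (hε : 0 < ε)
    (F : State n → ℝ) (S : Strategy n) (z₀ : State n) : ℝ :=
  ∫ ω, F (ω (hitIndex Ω T ε ω)) ∂(gameLaw hp hε S z₀)

/-- The value of the game, `u^ε(z₀) = sup_S 𝔼_S^{z₀}[F(x_τ, t_τ)]`. -/
def gameValue {n : ℕ} (Ω : Set (E n)) (T : ℝ) {p ε : ℝ} (hp : 2 < p) (hε : 0 < ε)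
    (F : State n → ℝ) (z₀ : State n) : ℝ :=
  ⨆ S : Strategy n, expectedPayoff Ω T hp hε F S z₀

end

end DominativeGame

/-!
A solution `u` of the dynamic programming principle, evaluated along the game and stopped at the
exit from `Ω_T`, is a supermartingale under every strategy, and a martingale up to a loss `δ` per
step under a strategy whose directions come within `δ` of the supremum in the principle. The time
drops by `ε²` in every step, so the game started at time `t` ends within `N ≥ t / ε²` steps and
`u - N δ ≤ u^ε ≤ u`.

The near-optimal directions must be chosen as Borel functions of the position. Borel measurability
of `u` alone does not provide this, but the time slices of `u` have σ-compact superlevel sets: the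
boundary data are continuous on a closed set, and the property survives the passage from the slice
at time `t - ε²` to the slice at time `t`, since averages over balls are continuous and suprema over
directions are projections of superlevel sets along a compact factor. Measurable selectors of
σ-compact sets then give the strategies. The slices are bounded on bounded sets, which is all the
integrability the argument needs.
-/

namespace DominativeGame

noncomputable section

section SigmaCompact

variable {X Y : Type*} [TopologicalSpace X] [TopologicalSpace Y]

theorem isSigmaCompact_inter [T2Space X] {s t : Set X} (hs : IsSigmaCompact s)
    (ht : IsSigmaCompact t) : IsSigmaCompact (s ∩ t) := by
  obtain ⟨K, hK, rfl⟩ := hs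
  obtain ⟨L, hL, rfl⟩ := ht
  rw [Set.iUnion_inter_iUnion, ← Set.iUnion_prod' (fun ij : ℕ × ℕ => K ij.1 ∩ L ij.2)]
  exact isSigmaCompact_iUnion_of_isCompact _ fun ij => (hK ij.1).inter (hL ij.2)

theorem isSigmaCompact_union {s t : Set X} (hs : IsSigmaCompact s) (ht : IsSigmaCompact t) :
    IsSigmaCompact (s ∪ t) := by
  rw [Set.union_eq_iUnion]
  exact isSigmaCompact_iUnion _ (Bool.forall_bool.2 ⟨ht, hs⟩)

theorem isSigmaCompact_of_isClosed [SigmaCompactSpace X] {s : Set X} (hs : IsClosed s) :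
    IsSigmaCompact s :=
  isSigmaCompact_univ.of_isClosed_subset hs (Set.subset_univ s)

theorem isSigmaCompact_of_isOpen {X : Type*} [PseudoEMetricSpace X] [SigmaCompactSpace X]
    {s : Set X} (hs : IsOpen s) : IsSigmaCompact s := by
  obtain ⟨C, hC, -, rfl, -⟩ := hs.exists_iUnion_isClosed
  exact isSigmaCompact_iUnion _ fun i => isSigmaCompact_of_isClosed (hC i)

theorem isSigmaCompact_preimage [SigmaCompactSpace X] [T2Space Y] {s : Set Y}
    (hs : IsSigmaCompact s) {f : X → Y} (hf : Continuous f) : IsSigmaCompact (f ⁻¹' s) := by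
  obtain ⟨K, hK, rfl⟩ := hs
  rw [Set.preimage_iUnion]
  exact isSigmaCompact_iUnion _ fun i => isSigmaCompact_of_isClosed ((hK i).isClosed.preimage hf)

theorem measurableSet_of_isSigmaCompact [T2Space X] [MeasurableSpace X]
    [OpensMeasurableSpace X] {s : Set X} (hs : IsSigmaCompact s) : MeasurableSet s := by
  obtain ⟨K, hK, rfl⟩ := hs
  exact MeasurableSet.iUnion fun i => (hK i).measurableSet

end SigmaCompact

section Superlevels

variable {X Y : Type*}

/-- A real function all of whose strict superlevel sets are σ-compact. Unlike Borel measurability,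
this regularity is inherited by suprema over a parameter, because continuous images of σ-compact
sets are σ-compact. -/
def HasSigmaCompactSuperlevels [TopologicalSpace X] (f : X → ℝ) : Prop :=
  ∀ c : ℝ, IsSigmaCompact {x | c < f x}

namespace HasSigmaCompactSuperlevels

theorem of_continuous [PseudoEMetricSpace X] [SigmaCompactSpace X] {f : X → ℝ}
    (hf : Continuous f) : HasSigmaCompactSuperlevels f :=
  fun _ => isSigmaCompact_of_isOpen (isOpen_lt continuous_const hf)

theorem indicator_of_continuousOn [EMetricSpace X] [SigmaCompactSpace X] {A : Set X} {f : X → ℝ}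
    (hA : IsClosed A) (hf : ContinuousOn f A) : HasSigmaCompactSuperlevels (A.indicator f) := by
  intro c
  have : SigmaCompactSpace A :=
    isSigmaCompact_iff_sigmaCompactSpace.1 (isSigmaCompact_of_isClosed hA)
  have hsplit : {x | c < A.indicator f x} =
      Subtype.val '' {x : A | c < A.domRestrict f x} ∪ Aᶜ ∩ {_x | c < 0} := by
    ext x
    by_cases hx : x ∈ A <;> simp [hx]
  rw [hsplit]
  exact isSigmaCompact_union
    ((of_continuous (continuousOn_iff_continuous_domRestrict.1 hf) c).image continuous_subtype_val)
    (isSigmaCompact_of_isOpen (hA.isOpen_compl.inter isOpen_const))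

theorem piecewise [EMetricSpace X] [SigmaCompactSpace X] {A : Set X} [DecidablePred (· ∈ A)]
    {f g : X → ℝ} (hA : IsOpen A) (hf : HasSigmaCompactSuperlevels f)
    (hg : HasSigmaCompactSuperlevels g) : HasSigmaCompactSuperlevels (A.piecewise f g) := by
  intro c
  have hsplit : {x | c < A.piecewise f g x} = A ∩ {x | c < f x} ∪ Aᶜ ∩ {x | c < g x} := by
    ext x
    by_cases hx : x ∈ A <;> simp [hx]
  rw [hsplit]
  exact isSigmaCompact_union (isSigmaCompact_inter (isSigmaCompact_of_isOpen hA) (hf c))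
    (isSigmaCompact_inter (isSigmaCompact_of_isClosed hA.isClosed_compl) (hg c))

variable [TopologicalSpace X] [TopologicalSpace Y]

theorem comp [SigmaCompactSpace X] [T2Space Y] {f : Y → ℝ} (hf : HasSigmaCompactSuperlevels f)
    {g : X → Y} (hg : Continuous g) : HasSigmaCompactSuperlevels fun x => f (g x) :=
  fun c => isSigmaCompact_preimage (hf c) hg

theorem add [T2Space X] {f g : X → ℝ} (hf : HasSigmaCompactSuperlevels f)
    (hg : HasSigmaCompactSuperlevels g) : HasSigmaCompactSuperlevels fun x => f x + g x := by
  intro c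
  have hsplit : {x | c < f x + g x} = ⋃ q : ℚ, {x | (q : ℝ) < f x} ∩ {x | c - q < g x} := by
    ext x
    simp only [Set.mem_ofPred_eq, Set.mem_iUnion, Set.mem_inter_iff]
    constructor
    · intro h
      obtain ⟨q, hgq, hqf⟩ := exists_rat_btwn (show c - g x < f x by linarith)
      exact ⟨q, hqf, by linarith⟩
    · rintro ⟨q, hqf, hqg⟩
      linarith
  rw [hsplit]
  exact isSigmaCompact_iUnion _ fun q => isSigmaCompact_inter (hf _) (hg _)

theorem const_mul {f : X → ℝ} (hf : HasSigmaCompactSuperlevels f) {a : ℝ} (ha : 0 < a) :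
    HasSigmaCompactSuperlevels fun x => a * f x := by
  intro c
  simpa only [div_lt_iff₀' ha] using hf (c / a)

theorem measurable [T2Space X] [MeasurableSpace X] [OpensMeasurableSpace X] {f : X → ℝ}
    (hf : HasSigmaCompactSuperlevels f) : Measurable f :=
  measurable_of_Ioi fun c => measurableSet_of_isSigmaCompact (hf c)

theorem iSup [Nonempty Y] {f : X × Y → ℝ} (hf : HasSigmaCompactSuperlevels f)
    (hb : ∀ x, BddAbove (Set.range fun y => f (x, y))) :
    HasSigmaCompactSuperlevels fun x => ⨆ y, f (x, y) := by
  intro c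
  have hproj : {x | c < ⨆ y, f (x, y)} = Prod.fst '' {q | c < f q} := by
    ext x
    simp [lt_ciSup_iff (hb x)]
  rw [hproj]
  exact (hf c).image continuous_fst

end HasSigmaCompactSuperlevels

end Superlevels

section Selection

variable {X Y : Type*} [TopologicalSpace X] [T2Space X]

theorem isCompact_slice [TopologicalSpace Y] [T2Space Y] {K : Set (X × Y)} (hK : IsCompact K)
    (x : X) : IsCompact {y | (x, y) ∈ K} :=
  (hK.image continuous_snd).of_isClosed_subset (hK.isClosed.preimage (.prodMk_right x))
    fun y hy => ⟨(x, y), hy, rfl⟩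

variable [MeasurableSpace X] [OpensMeasurableSpace X]

theorem measurable_sInf_slice {K : Set (X × ℝ)} (hK : IsCompact K) :
    Measurable fun x => sInf {r | (x, r) ∈ K} := by
  refine measurable_of_Iic fun c => ?_
  -- Off the projection of `K` the slice is empty, and `sInf ∅ = 0`.
  have hpre : (fun x => sInf {r | (x, r) ∈ K}) ⁻¹' Set.Iic c =
      Prod.fst '' (K ∩ {q | q.2 ≤ c}) ∪ (Prod.fst '' K)ᶜ ∩ {_x | 0 ≤ c} := by
    ext x
    have hslice := isCompact_slice hK x
    rcases Set.eq_empty_or_nonempty {r | (x, r) ∈ K} with hx | hx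
    · have : ∀ r, (x, r) ∉ K := Set.eq_empty_iff_forall_notMem.1 hx
      simp [this]
    · have : sInf {r | (x, r) ∈ K} ≤ c ↔ ∃ r, (x, r) ∈ K ∧ r ≤ c :=
        ⟨fun h => ⟨_, hslice.sInf_mem hx, h⟩,
          fun ⟨r, hr, hrc⟩ => (csInf_le hslice.bddBelow hr).trans hrc⟩
      obtain ⟨r, hr⟩ := hx
      have hmem : ∃ r, (x, r) ∈ K := ⟨r, hr⟩
      simp [this, hmem]
  rw [hpre]
  refine .union (IsCompact.measurableSet ?_)
    (.inter (hK.image continuous_fst).measurableSet.compl (.const _))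
  exact (hK.inter_right (isClosed_le continuous_snd continuous_const)).image continuous_fst

variable [MetricSpace Y] [CompactSpace Y] [Nonempty Y] [MeasurableSpace Y] [BorelSpace Y]

theorem exists_measurable_selector_of_isCompact {K : Set (X × Y)} (hK : IsCompact K) :
    ∃ s : X → Y, Measurable s ∧ ∀ x ∈ Prod.fst '' K, (x, s x) ∈ K := by
  -- Parametrize `Y` by the Cantor set, so that the slices of `K` become compact sets of reals, and
  -- select the least parameter.
  obtain ⟨φ, hφ, hφ_surj⟩ := exists_nat_bool_continuous_surjective_of_compact Y
  let ψ : cantorSet → Y := φ ∘ cantorSetHomeomorphNatToBool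
  have hψ : Continuous ψ := hφ.comp cantorSetHomeomorphNatToBool.continuous
  have hψ_surj : Function.Surjective ψ := hφ_surj.comp cantorSetHomeomorphNatToBool.surjective
  have : CompactSpace cantorSet := isCompact_iff_compactSpace.1 isCompact_cantorSet
  let C : Set (X × cantorSet) := {q | (q.1, ψ q.2) ∈ K}
  have hC : IsCompact C :=
    ((hK.image continuous_fst).prod isCompact_univ).of_isClosed_subset
      (hK.isClosed.preimage (by fun_prop)) fun q hq => ⟨⟨_, hq, rfl⟩, trivial⟩
  let L : Set (X × ℝ) := Prod.map id Subtype.val '' C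
  have hL : IsCompact L := hC.image (by fun_prop)
  obtain ⟨ψ', hψ', hψ'_eq⟩ := (MeasurableEmbedding.subtype_coe
    isClosed_cantorSet.measurableSet).exists_measurable_extend hψ.measurable fun _ => ‹Nonempty Y›
  refine ⟨fun x => ψ' (sInf {r | (x, r) ∈ L}), hψ'.comp (measurable_sInf_slice hL), ?_⟩
  rintro _ ⟨⟨x, y⟩, hxy, rfl⟩
  obtain ⟨c, rfl⟩ := hψ_surj y
  obtain ⟨⟨_, d⟩, hd, heq⟩ := (isCompact_slice hL x).sInf_mem ⟨c, (x, c), hxy, rfl⟩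
  obtain ⟨rfl, hds⟩ := Prod.mk.inj heq
  simp only [← hds, ← Function.comp_apply (f := ψ') (g := Subtype.val), hψ'_eq]
  exact hd

theorem exists_measurable_selector_of_isSigmaCompact {W : Set (X × Y)} (hW : IsSigmaCompact W) :
    ∃ s : X → Y, Measurable s ∧ ∀ x ∈ Prod.fst '' W, (x, s x) ∈ W := by
  classical
  obtain ⟨K, hK, rfl⟩ := hW
  choose s hs hsK using fun i => exists_measurable_selector_of_isCompact (hK i)
  have hproj : ∀ i, MeasurableSet (Prod.fst '' K i) := fun i =>
    ((hK i).image continuous_fst).measurableSet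
  rw [Set.image_iUnion]
  have hex : ∀ x, ∃ i, x ∈ Prod.fst '' K i ∨ x ∉ ⋃ j, Prod.fst '' K j := by
    intro x
    by_cases hx : x ∈ ⋃ j, Prod.fst '' K j
    · exact (Set.mem_iUnion.1 hx).imp fun i hi => Or.inl hi
    · exact ⟨0, Or.inr hx⟩
  have hfind : Measurable fun x => Nat.find (hex x) :=
    measurable_find hex fun i => (hproj i).union (MeasurableSet.iUnion hproj).compl
  have hs_prod : Measurable fun q : ℕ × X => s q.1 q.2 := measurable_from_prod_countable_right hs
  refine ⟨fun x => s (Nat.find (hex x)) x, hs_prod.comp (hfind.prodMk measurable_id), ?_⟩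
  intro x hx
  exact Set.mem_iUnion.2 ⟨_, hsK _ x ((Nat.find_spec (hex x)).resolve_right (not_not.2 hx))⟩

theorem HasSigmaCompactSuperlevels.exists_measurable_near_maximizer {f : X × Y → ℝ}
    (hf : HasSigmaCompactSuperlevels f) (hb : ∀ x, BddAbove (Set.range fun y => f (x, y)))
    {δ : ℝ} (hδ : 0 < δ) :
    ∃ s : X → Y, Measurable s ∧ ∀ x, (⨆ y, f (x, y)) - δ ≤ f (x, s x) := by
  choose s hs hsW using fun j : ℤ => exists_measurable_selector_of_isSigmaCompact (hf (j * δ))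
  let j : X → ℤ := fun x => ⌈(⨆ y, f (x, y)) / δ⌉ - 1
  have hj : Measurable j :=
    (Int.measurable_ceil.comp ((hf.iSup hb).measurable.div_const δ)).sub_const 1
  have hs_prod : Measurable fun q : ℤ × X => s q.1 q.2 := measurable_from_prod_countable_right hs
  refine ⟨fun x => s (j x) x, hs_prod.comp (hj.prodMk measurable_id), fun x => ?_⟩
  have hlt : (j x : ℝ) * δ < ⨆ y, f (x, y) := by
    rw [← lt_div_iff₀ hδ]
    push_cast [j]
    linarith [Int.ceil_lt_add_one ((⨆ y, f (x, y)) / δ)]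
  have hle : ⨆ y, f (x, y) ≤ ((j x : ℝ) + 1) * δ := by
    rw [← div_le_iff₀ hδ]
    push_cast [j]
    linarith [Int.le_ceil ((⨆ y, f (x, y)) / δ)]
  obtain ⟨y, hy⟩ := (lt_ciSup_iff (hb x)).1 hlt
  have hsel : (j x : ℝ) * δ < f (x, s (j x) x) := hsW (j x) x ⟨(x, y), hy, rfl⟩
  linarith

end Selection

section BoundedOnBounded

variable {X : Type*} [PseudoMetricSpace X] {f g : X → ℝ}

/-- The function `f` is bounded on every bounded set. This is the growth condition carried along
the time slices of a solution of the dynamic programming principle when `Ω` is unbounded. -/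
def BoundedOnBounded (f : X → ℝ) : Prop :=
  ∀ ⦃B : Set X⦄, Bornology.IsBounded B → ∃ M, ∀ x ∈ B, |f x| ≤ M

namespace BoundedOnBounded

theorem piecewise {A : Set X} [DecidablePred (· ∈ A)] (hf : BoundedOnBounded f)
    (hg : BoundedOnBounded g) : BoundedOnBounded (A.piecewise f g) := by
  intro B hB
  obtain ⟨M, hM⟩ := hf hB
  obtain ⟨N, hN⟩ := hg hB
  refine ⟨max M N, fun x hx => ?_⟩
  by_cases hxA : x ∈ A
  · simpa [hxA] using Or.inl (hM x hx)
  · simpa [hxA] using Or.inr (hN x hx)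

theorem indicator_of_continuousOn [ProperSpace X] {A : Set X} (hA : IsClosed A)
    (hf : ContinuousOn f A) : BoundedOnBounded (A.indicator f) := by
  intro B hB
  have hcompact : IsCompact (closure B ∩ A) := hB.isCompact_closure.inter_right hA
  obtain ⟨M, hM⟩ := hcompact.exists_bound_of_continuousOn (hf.mono Set.inter_subset_right)
  refine ⟨max M 0, fun x hx => ?_⟩
  by_cases hxA : x ∈ A
  · simpa [hxA] using Or.inl (hM x ⟨subset_closure hx, hxA⟩)
  · simp [hxA]

theorem locallyIntegrable [ProperSpace X] [MeasurableSpace X] [OpensMeasurableSpace X]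
    {μ : Measure X} [IsFiniteMeasureOnCompacts μ] (hf : BoundedOnBounded f)
    (hm : AEStronglyMeasurable f μ) : LocallyIntegrable f μ := by
  intro x
  obtain ⟨M, hM⟩ := hf (Metric.isBounded_ball (x := x) (r := 1))
  exact ⟨_, Metric.ball_mem_nhds x one_pos, .of_bound measure_ball_lt_top hm.restrict M
    (ae_restrict_of_forall_mem Metric.isOpen_ball.measurableSet hM)⟩

end BoundedOnBounded

end BoundedOnBounded

section Average

variable {X G : Type*} [MeasurableSpace X] [NormedAddCommGroup G] [NormedSpace ℝ G]

theorem norm_setAverage_le_of_norm_le_const {μ : Measure X} {s : Set X} {f : X → G} {C : ℝ}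
    (hs : MeasurableSet s) (hs_pos : μ s ≠ 0) (hs_top : μ s ≠ ⊤) (hf : ∀ x ∈ s, ‖f x‖ ≤ C) :
    ‖⨍ x in s, f x ∂μ‖ ≤ C := by
  have := cond_isProbabilityMeasure_of_finite hs_pos hs_top
  rw [setAverage_eq']
  exact (norm_integral_le_of_norm_le_const (ae_cond_of_forall_mem hs hf)).trans_eq
    (by rw [probReal_univ, mul_one])

variable [NormedAddCommGroup X] [NormedSpace ℝ X] [FiniteDimensional ℝ X] [BorelSpace X]

theorem continuous_setIntegral_ball {μ : Measure X} [μ.IsAddHaarMeasure] {w : X → G}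
    (hw : LocallyIntegrable w μ) {r : ℝ} (hr : r ≠ 0) :
    Continuous fun x => ∫ y in Metric.ball x r, w y ∂μ := by
  simp only [← integral_indicator (Metric.isOpen_ball (ε := r)).measurableSet]
  refine continuous_iff_continuousAt.2 fun x₀ => ?_
  refine continuousAt_of_dominated
    (bound := (Metric.ball x₀ (r + 1)).indicator fun y => ‖w y‖) ?_ ?_ ?_ ?_
  · exact .of_forall fun x => hw.aestronglyMeasurable.indicator Metric.isOpen_ball.measurableSet
  · filter_upwards [Metric.ball_mem_nhds x₀ one_pos] with x hx
    refine .of_forall fun y => ?_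
    rw [norm_indicator_eq_indicator_norm]
    refine Set.indicator_le_indicator_of_subset (Metric.ball_subset_ball' ?_)
      (fun _ => norm_nonneg _) y
    linarith [Metric.mem_ball.1 hx]
  · exact (integrable_indicator_iff Metric.isOpen_ball.measurableSet).2
      ((hw.integrableOn_isCompact (isCompact_closedBall x₀ (r + 1))).mono_set
        Metric.ball_subset_closedBall).norm
  · have hsphere : ∀ᵐ y ∂μ, y ∉ Metric.sphere x₀ r :=
      measure_eq_zero_iff_ae_notMem.1 (Measure.addHaar_sphere_of_ne_zero _ _ hr)
    filter_upwards [hsphere] with y hy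
    have hdist : Continuous fun x : X => dist y x := by fun_prop
    rcases lt_or_gt_of_ne hy with h | h
    · refine (continuousAt_const (y := w y)).congr ?_
      filter_upwards [hdist.continuousAt.eventually_lt continuousAt_const h] with x hx
      exact (Set.indicator_of_mem (Metric.mem_ball.2 hx) _).symm
    · refine (continuousAt_const (y := (0 : G))).congr ?_
      filter_upwards [continuousAt_const.eventually_lt hdist.continuousAt h] with x hx
      exact (Set.indicator_of_notMem (fun hxy => hx.not_gt (Metric.mem_ball.1 hxy)) _).symm

theorem continuous_setAverage_ball {μ : Measure X} [μ.IsAddHaarMeasure] {w : X → G}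
    (hw : LocallyIntegrable w μ) {r : ℝ} (hr : r ≠ 0) :
    Continuous fun x => ⨍ y in Metric.ball x r, w y ∂μ := by
  simp only [setAverage_eq, Measure.addHaar_real_ball_center]
  exact (continuous_setIntegral_ball hw hr).const_smul _

end Average

section Operator

variable {n : ℕ} {p ε : ℝ} {w : E n → ℝ}

theorem alpha_pos (hp : 2 < p) : 0 < alpha n p :=
  div_pos (by linarith) (by positivity)

theorem beta_pos (hp : 2 < p) : 0 < beta n p :=
  div_pos (by positivity) (by positivity)

theorem alpha_add_beta (hp : 2 < p) : alpha n p + beta n p = 1 := by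
  have : p + n ≠ 0 := by positivity
  unfold alpha beta
  field_simp
  ring

theorem nonempty_sphere (hn : 1 ≤ n) : Nonempty (Metric.sphere (0 : E n) 1) := by
  have : Nonempty (Fin n) := ⟨⟨0, hn⟩⟩
  exact (NormedSpace.sphere_nonempty.2 zero_le_one).to_subtype

theorem add_smul_mem_closedBall (hε : 0 ≤ ε) (x : E n) (σ : Metric.sphere (0 : E n) 1) :
    x + ε • (σ : E n) ∈ Metric.closedBall x ε := by
  simp [norm_smul, abs_of_nonneg hε]

theorem sub_smul_mem_closedBall (hε : 0 ≤ ε) (x : E n) (σ : Metric.sphere (0 : E n) 1) :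
    x - ε • (σ : E n) ∈ Metric.closedBall x ε := by
  simp [norm_smul, abs_of_nonneg hε]

/-- The mean of `w` at the two endpoints `x ± ε σ`, as a function of the pair `(x, σ)`. -/
def endpointMean (ε : ℝ) (w : E n → ℝ) (q : E n × Metric.sphere (0 : E n) 1) : ℝ :=
  (w (q.1 + ε • (q.2 : E n)) + w (q.1 - ε • (q.2 : E n))) / 2

theorem abs_endpointMean_le (hε : 0 ≤ ε) {x : E n} {M : ℝ}
    (hM : ∀ y ∈ Metric.closedBall x ε, |w y| ≤ M) (σ : Metric.sphere (0 : E n) 1) :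
    |endpointMean ε w (x, σ)| ≤ M := by
  have hadd := hM _ (add_smul_mem_closedBall hε x σ)
  have hsub := hM _ (sub_smul_mem_closedBall hε x σ)
  rw [endpointMean, abs_div, abs_two, div_le_iff₀ two_pos]
  linarith [abs_add_le (w (x + ε • (σ : E n))) (w (x - ε • (σ : E n)))]

theorem BoundedOnBounded.bddAbove_endpointMean (hw : BoundedOnBounded w) (hε : 0 ≤ ε)
    (x : E n) : BddAbove (Set.range fun σ => endpointMean ε w (x, σ)) := by
  obtain ⟨M, hM⟩ := hw (Metric.isBounded_closedBall (x := x) (r := ε))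
  exact ⟨M, Set.forall_mem_range.2 fun σ => le_of_abs_le (abs_endpointMean_le hε hM σ)⟩

theorem HasSigmaCompactSuperlevels.endpointMean (hw : HasSigmaCompactSuperlevels w) :
    HasSigmaCompactSuperlevels (endpointMean ε w) := by
  have hadd := hw.comp (g := fun q : E n × Metric.sphere (0 : E n) 1 => q.1 + ε • (q.2 : E n))
    (by fun_prop)
  have hsub := hw.comp (g := fun q : E n × Metric.sphere (0 : E n) 1 => q.1 - ε • (q.2 : E n))
    (by fun_prop)
  simpa only [inv_mul_eq_div] using! (hadd.add hsub).const_mul (a := 2⁻¹) (by norm_num)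

/-- The dynamic programming operator: the right-hand side of the dynamic programming principle,
applied to the time slice `w` of the previous round. -/
def dppStep (p ε : ℝ) (w : E n → ℝ) (x : E n) : ℝ :=
  beta n p * (⨍ y in Metric.ball x ε, w y) + alpha n p * ⨆ σ, endpointMean ε w (x, σ)

theorem dppStep_congr (hε : 0 ≤ ε) {w' : E n → ℝ} {x : E n}
    (h : ∀ y ∈ Metric.closedBall x ε, w y = w' y) : dppStep p ε w x = dppStep p ε w' x := by
  have havg : ⨍ y in Metric.ball x ε, w y = ⨍ y in Metric.ball x ε, w' y :=
    setAverage_congr_fun Metric.isOpen_ball.measurableSet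
      (.of_forall fun y hy => h y (Metric.ball_subset_closedBall hy))
  have hmean : ∀ σ, endpointMean ε w (x, σ) = endpointMean ε w' (x, σ) := fun σ => by
    simp only [endpointMean, h _ (add_smul_mem_closedBall hε x σ),
      h _ (sub_smul_mem_closedBall hε x σ)]
  simp only [dppStep, havg, hmean]

theorem abs_dppStep_le (hn : 1 ≤ n) (hp : 2 < p) (hε : 0 < ε) {x : E n} {M : ℝ}
    (hM : ∀ y ∈ Metric.closedBall x ε, |w y| ≤ M) : |dppStep p ε w x| ≤ M := by
  have := nonempty_sphere hn
  have hα := alpha_pos (n := n) hp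
  have hβ := beta_pos (n := n) hp
  have havg : |⨍ y in Metric.ball x ε, w y| ≤ M := by
    rw [← Real.norm_eq_abs]
    exact norm_setAverage_le_of_norm_le_const Metric.isOpen_ball.measurableSet
      (Metric.measure_ball_pos _ _ hε).ne' measure_ball_lt_top.ne
      fun y hy => hM y (Metric.ball_subset_closedBall hy)
  have hmean := fun σ => abs_le.1 (abs_endpointMean_le hε.le hM σ)
  have hsup : |⨆ σ, endpointMean ε w (x, σ)| ≤ M := by
    refine abs_le.2 ⟨?_, ciSup_le fun σ => (hmean σ).2⟩
    obtain ⟨σ⟩ := this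
    exact (hmean σ).1.trans (le_ciSup ⟨M, Set.forall_mem_range.2 fun σ => (hmean σ).2⟩ σ)
  calc |dppStep p ε w x|
      ≤ beta n p * |⨍ y in Metric.ball x ε, w y|
          + alpha n p * |⨆ σ, endpointMean ε w (x, σ)| := by
        refine (abs_add_le _ _).trans_eq ?_
        rw [abs_mul, abs_mul, abs_of_pos hα, abs_of_pos hβ]
    _ ≤ beta n p * M + alpha n p * M := by gcongr
    _ = M := by rw [← add_mul, add_comm, alpha_add_beta hp, one_mul]

theorem BoundedOnBounded.dppStep (hn : 1 ≤ n) (hp : 2 < p) (hε : 0 < ε)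
    (hw : BoundedOnBounded w) : BoundedOnBounded (dppStep p ε w) := by
  intro B hB
  obtain ⟨M, hM⟩ := hw (hB.cthickening (δ := ε))
  exact ⟨M, fun x hx => abs_dppStep_le hn hp hε fun y hy =>
    hM y (Metric.closedBall_subset_cthickening hx ε hy)⟩

theorem HasSigmaCompactSuperlevels.dppStep (hn : 1 ≤ n) (hp : 2 < p) (hε : 0 < ε)
    (hw : HasSigmaCompactSuperlevels w) (hb : BoundedOnBounded w) :
    HasSigmaCompactSuperlevels (dppStep p ε w) := by
  have := nonempty_sphere hn
  have havg : Continuous fun x => beta n p * ⨍ y in Metric.ball x ε, w y :=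
    continuous_const.mul (continuous_setAverage_ball
      (hb.locallyIntegrable hw.measurable.aestronglyMeasurable) hε.ne')
  exact (of_continuous havg).add
    ((hw.endpointMean.iSup (hb.bddAbove_endpointMean hε.le)).const_mul (alpha_pos hp))

end Operator

section Geometry

theorem inter_frontier_nonempty_of_isPreconnected {X : Type*} [TopologicalSpace X] {s t : Set X}
    (hs : IsPreconnected s) (ht : (s ∩ t).Nonempty) (htc : (s ∩ tᶜ).Nonempty) :
    (s ∩ frontier t).Nonempty := by
  by_contra h
  have hsub : s ⊆ interior t ∪ interior tᶜ := by
    rw [← compl_frontier_eq_union_interior]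
    exact fun x hxs hx => h ⟨x, hxs, hx⟩
  obtain ⟨x, hxs, hxt⟩ := ht
  obtain ⟨y, hys, hyt⟩ := htc
  have hx : x ∈ interior t := (hsub hxs).resolve_right fun hx => interior_subset hx hxt
  exact hyt (interior_subset (hs.subset_left_of_subset_union isOpen_interior isOpen_interior
    (disjoint_compl_right.mono interior_subset interior_subset) hsub ⟨x, hxs, hx⟩ hys))

variable {n : ℕ} {Ω : Set (E n)} {T ε : ℝ}

/-- The set `Ω_T ∪ Γ_ε` of the admissible states of the game. -/
abbrev domain (Ω : Set (E n)) (T ε : ℝ) : Set (State n) := cylinder Ω T ∪ boundaryStrip Ω T ε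

theorem mem_outerStrip_of_dist_le {x y : E n} (hx : x ∈ Ω) (hy : y ∉ Ω) (hd : dist y x ≤ ε) :
    y ∈ outerStrip Ω ε := by
  obtain ⟨w, hws, hw⟩ := inter_frontier_nonempty_of_isPreconnected
    (convex_segment y x).isPreconnected ⟨x, right_mem_segment ℝ y x, hx⟩
    ⟨y, left_mem_segment ℝ y x, hy⟩
  refine ⟨hy, (Metric.infDist_le_dist_of_mem hw).trans (le_trans ?_ hd)⟩
  linarith [dist_add_dist_of_mem_segment hws, dist_nonneg (x := w) (y := x)]

theorem isClosed_outerStrip (ho : IsOpen Ω) : IsClosed (outerStrip Ω ε) :=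
  ho.isClosed_compl.inter (isClosed_le (Metric.continuous_infDist_pt _) continuous_const)

theorem isClosed_union_outerStrip (ho : IsOpen Ω) (hε : 0 ≤ ε) :
    IsClosed (Ω ∪ outerStrip Ω ε) := by
  have hclosure : closure Ω ⊆ Ω ∪ outerStrip Ω ε := fun x hx => by
    by_cases hxΩ : x ∈ Ω
    · exact Or.inl hxΩ
    · have hfr : x ∈ frontier Ω := by rw [ho.frontier_eq]; exact ⟨hx, hxΩ⟩
      exact Or.inr ⟨hxΩ, (Metric.infDist_zero_of_mem hfr).trans_le hε⟩
  have heq : Ω ∪ outerStrip Ω ε = closure Ω ∪ outerStrip Ω ε :=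
    (Set.union_subset_union_left _ subset_closure).antisymm
      (Set.union_subset hclosure Set.subset_union_right)
  rw [heq]
  exact isClosed_closure.union (isClosed_outerStrip ho)

theorem isClosed_boundaryStrip (ho : IsOpen Ω) (hT : 0 ≤ T) (hε : 0 ≤ ε) :
    IsClosed (boundaryStrip Ω T ε) := by
  -- The part of the strip at nonpositive times is closed only together with the outer strip.
  have heq : boundaryStrip Ω T ε = outerStrip Ω ε ×ˢ Set.Icc (-ε ^ 2) T ∪
      (Ω ∪ outerStrip Ω ε) ×ˢ Set.Icc (-ε ^ 2) 0 := by
    have hsub : outerStrip Ω ε ×ˢ Set.Icc (-ε ^ 2) 0 ⊆ outerStrip Ω ε ×ˢ Set.Icc (-ε ^ 2) T :=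
      Set.prod_mono_right (Set.Icc_subset_Icc_right hT)
    rw [Set.union_prod, Set.union_comm (Ω ×ˢ _), ← Set.union_assoc, Set.union_eq_left.2 hsub,
      boundaryStrip]
  rw [heq]
  exact ((isClosed_outerStrip ho).prod isClosed_Icc).union
    ((isClosed_union_outerStrip ho hε).prod isClosed_Icc)

theorem isOpen_cylinder (ho : IsOpen Ω) : IsOpen (cylinder Ω T) := ho.prod isOpen_Ioo

theorem disjoint_cylinder_boundaryStrip : Disjoint (cylinder Ω T) (boundaryStrip Ω T ε) := by
  refine Set.disjoint_left.2 ?_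
  rintro z ⟨hzΩ, hz0, -⟩ (hz | hz)
  · exact hz.1.1 hzΩ
  · exact hz.2.2.not_gt hz0

theorem measurableSet_domain (ho : IsOpen Ω) (hT : 0 ≤ T) (hε : 0 ≤ ε) :
    MeasurableSet (domain Ω T ε) :=
  (isOpen_cylinder ho).measurableSet.union (isClosed_boundaryStrip ho hT hε).measurableSet

theorem mem_domain_of_dist_le {x y : E n} {t : ℝ} (hxt : (x, t) ∈ cylinder Ω T)
    (hd : dist y x ≤ ε) : (y, t - ε ^ 2) ∈ domain Ω T ε := by
  obtain ⟨hx, ht0 : 0 < t, htT : t < T⟩ := hxt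
  have hlow : -ε ^ 2 ≤ t - ε ^ 2 := by linarith
  have hup : t - ε ^ 2 < T := by linarith [sq_nonneg ε]
  by_cases hy : y ∈ Ω
  · rcases lt_or_ge 0 (t - ε ^ 2) with h | h
    · exact Or.inl ⟨hy, h, hup⟩
    · exact Or.inr (Or.inr ⟨hy, hlow, h⟩)
  · exact Or.inr (Or.inl ⟨mem_outerStrip_of_dist_le hx hy hd, hlow, hup.le⟩)

end Geometry

section StepLaw

variable {n : ℕ} {p ε : ℝ}

theorem ae_stepLaw (hε : 0 ≤ ε) (z : State n) (σ : Metric.sphere (0 : E n) 1) :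
    ∀ᵐ y ∂(stepLaw p ε z σ), y.1 ∈ Metric.closedBall z.1 ε ∧ y.2 = z.2 - ε ^ 2 := by
  have hmeas : MeasurableSet
      {y : State n | y.1 ∈ Metric.closedBall z.1 ε ∧ y.2 = z.2 - ε ^ 2} :=
    (measurable_fst Metric.isClosed_closedBall.measurableSet).inter
      (measurable_snd (measurableSet_singleton _))
  simp only [stepLaw, ae_add_measure_iff]
  refine ⟨⟨Measure.ae_smul_measure ?_ _, Measure.ae_smul_measure ?_ _⟩,
    Measure.ae_smul_measure ?_ _⟩
  · refine (ae_map_iff (by fun_prop) hmeas).2 ?_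
    exact ae_cond_of_forall_mem Metric.isOpen_ball.measurableSet
      fun y hy => ⟨Metric.ball_subset_closedBall hy, rfl⟩
  · exact (ae_dirac_iff hmeas).2 ⟨add_smul_mem_closedBall hε z.1 σ, rfl⟩
  · exact (ae_dirac_iff hmeas).2 ⟨sub_smul_mem_closedBall hε z.1 σ, rfl⟩

theorem integrable_stepLaw (hp : 2 < p) (hε : 0 < ε) {v : State n → ℝ} (hv : Measurable v)
    {z : State n} (hb : BoundedOnBounded fun y => v (y, z.2 - ε ^ 2))
    (σ : Metric.sphere (0 : E n) 1) : Integrable v (stepLaw p ε z σ) := by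
  have := isProbabilityMeasure_stepLaw hp hε z σ
  obtain ⟨M, hM⟩ := hb (Metric.isBounded_closedBall (x := z.1) (r := ε))
  refine .of_bound hv.aestronglyMeasurable M ?_
  filter_upwards [ae_stepLaw hε.le z σ] with ⟨y, t⟩ ⟨hy, ht⟩
  obtain rfl : t = z.2 - ε ^ 2 := ht
  exact hM y hy

theorem integral_stepLaw (hp : 2 < p) {v : State n → ℝ} (hv : Measurable v)
    {z : State n} {σ : Metric.sphere (0 : E n) 1} (hint : Integrable v (stepLaw p ε z σ)) :
    ∫ y, v y ∂(stepLaw p ε z σ) =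
      beta n p * (⨍ y in Metric.ball z.1 ε, v (y, z.2 - ε ^ 2)) +
        alpha n p * endpointMean ε (fun y => v (y, z.2 - ε ^ 2)) (z.1, σ) := by
  have hα : 0 ≤ alpha n p / 2 := by linarith [alpha_pos (n := n) hp]
  unfold stepLaw at hint ⊢
  have hint' := hint.left_of_add_measure
  rw [integral_add_measure hint' hint.right_of_add_measure,
    integral_add_measure hint'.left_of_add_measure hint'.right_of_add_measure,
    integral_smul_measure, integral_smul_measure, integral_smul_measure, integral_dirac,
    integral_dirac, integral_map (by fun_prop) hv.aestronglyMeasurable, setAverage_eq',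
    ENNReal.toReal_ofReal (beta_pos hp).le, ENNReal.toReal_ofReal hα]
  simp only [ProbabilityTheory.cond, smul_eq_mul, endpointMean]
  ring

end StepLaw

section DPP

variable {n : ℕ} {Ω : Set (E n)} {T p ε : ℝ} {F u : State n → ℝ}

theorem SatisfiesDPP.eq_dppStep (hu : SatisfiesDPP Ω T p ε F u) {x : E n} {t : ℝ}
    (hz : (x, t) ∈ cylinder Ω T) : u (x, t) = dppStep p ε (fun y => u (y, t - ε ^ 2)) x :=
  hu.interior x t hz

theorem SatisfiesDPP.indicator_domain (hu : SatisfiesDPP Ω T p ε F u) (hε : 0 ≤ ε) :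
    SatisfiesDPP Ω T p ε F ((domain Ω T ε).indicator u) where
  borel := by
    convert hu.borel using 2 with z
    exact Set.indicator_of_mem z.2 u
  interior x t hz := by
    rw [Set.indicator_of_mem (Set.mem_union_left _ hz), hu.eq_dppStep hz]
    refine dppStep_congr hε fun y hy => ?_
    exact (Set.indicator_of_mem (mem_domain_of_dist_le hz hy) u).symm
  boundary z hz := by rw [Set.indicator_of_mem (Set.mem_union_right _ hz), hu.boundary z hz]

theorem SatisfiesDPP.measurable (hu : SatisfiesDPP Ω T p ε F u)
    (hsupp : Function.support u ⊆ domain Ω T ε) (ho : IsOpen Ω) (hT : 0 ≤ T) (hε : 0 ≤ ε) :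
    Measurable u := by
  refine measurable_of_restrict_of_restrict_compl (measurableSet_domain ho hT hε) hu.borel ?_
  convert! (measurable_const : Measurable fun _ : ↥(domain Ω T ε)ᶜ => (0 : ℝ)) using 1
  funext z
  exact Function.notMem_support.1 fun hz => z.2 (hsupp hz)

open Classical in
theorem SatisfiesDPP.slice_eq (hu : SatisfiesDPP Ω T p ε F u)
    (hsupp : Function.support u ⊆ domain Ω T ε) (t : ℝ) :
    (fun x => u (x, t)) = {x | (x, t) ∈ cylinder Ω T}.piecewise
      (dppStep p ε fun y => u (y, t - ε ^ 2))
      ({x | (x, t) ∈ boundaryStrip Ω T ε}.indicator fun x => F (x, t)) := by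
  funext x
  by_cases hc : x ∈ {x | (x, t) ∈ cylinder Ω T}
  · rw [Set.piecewise_eq_of_mem _ _ _ hc, hu.eq_dppStep hc]
  · rw [Set.piecewise_eq_of_notMem _ _ _ hc]
    by_cases hb : x ∈ {x | (x, t) ∈ boundaryStrip Ω T ε}
    · rw [hu.boundary _ hb, Set.indicator_of_mem hb]
    · rw [Set.indicator_of_notMem hb]
      exact Function.notMem_support.1 fun hz => (hsupp hz).elim hc hb

theorem forall_of_forall_sub {P : ℝ → Prop} {δ : ℝ} (hδ : 0 < δ) (hbase : ∀ t ≤ 0, P t)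
    (hstep : ∀ t, 0 < t → P (t - δ) → P t) (t : ℝ) : P t := by
  obtain ⟨k, hk⟩ := exists_nat_ge (t / δ)
  rw [div_le_iff₀ hδ] at hk
  induction k generalizing t with
  | zero => exact hbase t (by simpa using hk)
  | succ k ih =>
    rcases le_or_gt t 0 with ht | ht
    · exact hbase t ht
    · refine hstep t ht (ih _ ?_)
      push_cast at hk
      linarith

theorem SatisfiesDPP.slice_regular (hu : SatisfiesDPP Ω T p ε F u)
    (hsupp : Function.support u ⊆ domain Ω T ε) (hn : 1 ≤ n) (ho : IsOpen Ω) (hT : 0 ≤ T)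
    (hp : 2 < p) (hε : 0 < ε) (hF : ContinuousOn F (boundaryStrip Ω T ε)) (t : ℝ) :
    BoundedOnBounded (fun x => u (x, t)) ∧ HasSigmaCompactSuperlevels fun x => u (x, t) := by
  classical
  have hbdry_closed : ∀ t, IsClosed {x | (x, t) ∈ boundaryStrip Ω T ε} := fun t =>
    (isClosed_boundaryStrip ho hT hε.le).preimage (.prodMk_left t)
  have hF_slice : ∀ t, ContinuousOn (fun x => F (x, t)) {x | (x, t) ∈ boundaryStrip Ω T ε} :=
    fun t => hF.comp (by fun_prop) fun x hx => hx
  have hbdry_bdd := fun t =>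
    BoundedOnBounded.indicator_of_continuousOn (hbdry_closed t) (hF_slice t)
  have hbdry_sigma := fun t =>
    HasSigmaCompactSuperlevels.indicator_of_continuousOn (hbdry_closed t) (hF_slice t)
  induction t using forall_of_forall_sub (δ := ε ^ 2) (by positivity) with
  | hbase t ht =>
    have hslice : (fun x => u (x, t)) =
        {x | (x, t) ∈ boundaryStrip Ω T ε}.indicator fun x => F (x, t) := by
      rw [hu.slice_eq hsupp t]
      funext x
      exact Set.piecewise_eq_of_notMem _ _ _ fun hx => ht.not_gt hx.2.1
    rw [hslice]
    exact ⟨hbdry_bdd t, hbdry_sigma t⟩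
  | hstep t _ ih =>
    rw [hu.slice_eq hsupp t]
    exact ⟨(ih.1.dppStep hn hp hε).piecewise (hbdry_bdd t),
      .piecewise ((isOpen_cylinder ho).preimage (.prodMk_left t)) (ih.2.dppStep hn hp hε ih.1)
        (hbdry_sigma t)⟩

theorem SatisfiesDPP.integral_stepLaw_le (hu : SatisfiesDPP Ω T p ε F u) (hm : Measurable u)
    (hb : ∀ t, BoundedOnBounded fun x => u (x, t)) (hp : 2 < p) (hε : 0 < ε) {z : State n}
    (hz : z ∈ cylinder Ω T) (σ : Metric.sphere (0 : E n) 1) :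
    ∫ y, u y ∂(stepLaw p ε z σ) ≤ u z := by
  have hα := alpha_pos (n := n) hp
  rw [integral_stepLaw hp hm (integrable_stepLaw hp hε hm (hb _) σ), hu.eq_dppStep hz, dppStep]
  gcongr
  exact le_ciSup ((hb _).bddAbove_endpointMean hε.le z.1) σ

theorem SatisfiesDPP.exists_near_optimal_direction (hu : SatisfiesDPP Ω T p ε F u)
    (hm : Measurable u) {t : ℝ} (hb : BoundedOnBounded fun x => u (x, t - ε ^ 2))
    (hs : HasSigmaCompactSuperlevels fun x => u (x, t - ε ^ 2)) (hn : 1 ≤ n) (hp : 2 < p)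
    (hε : 0 < ε) {δ : ℝ} (hδ : 0 < δ) :
    ∃ d : E n → Metric.sphere (0 : E n) 1, Measurable d ∧ ∀ x, (x, t) ∈ cylinder Ω T →
      u (x, t) - δ ≤ ∫ y, u y ∂(stepLaw p ε (x, t) (d x)) := by
  have := nonempty_sphere hn
  have hα := alpha_pos (n := n) hp
  have hα_le : alpha n p * δ ≤ δ :=
    mul_le_of_le_one_left hδ.le (by linarith [alpha_add_beta (n := n) hp, beta_pos (n := n) hp])
  obtain ⟨d, hd, hopt⟩ := hs.endpointMean.exists_measurable_near_maximizer
    (hb.bddAbove_endpointMean hε.le) hδ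
  refine ⟨d, hd, fun x hx => ?_⟩
  rw [integral_stepLaw hp hm (integrable_stepLaw hp hε hm hb (d x)), hu.eq_dppStep hx, dppStep]
  linarith [mul_le_mul_of_nonneg_left (hopt x) hα.le]

end DPP

section Trajectory

variable {X : Type*}

/-- The positions of the trajectory `ω` up to time `k`. -/
abbrev history (k : ℕ) (ω : ℕ → X) : Finset.Iic k → X := Preorder.frestrictLe (π := fun _ => X) k ω

/-- The event that a trajectory stays in `C` up to and including time `k`. -/
def alive (C : Set X) (k : ℕ) : Set (ℕ → X) := {ω | ∀ j ≤ k, ω j ∈ C}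

/-- The sum of the increments of `v` along a trajectory over the first `N` steps, where only the
steps made before the first exit from `C` count. -/
def gainUntilExit (C : Set X) (v : X → ℝ) (N : ℕ) (ω : ℕ → X) : ℝ :=
  ∑ k ∈ Finset.range N, (alive C k).indicator (fun ω => v (ω (k + 1)) - v (ω k)) ω

theorem gainUntilExit_eq_sub {C : Set X} (v : X → ℝ) {m N : ℕ} {ω : ℕ → X} (hm : ω m ∉ C)
    (hlt : ∀ j < m, ω j ∈ C) (hmN : m ≤ N) : gainUntilExit C v N ω = v (ω m) - v (ω 0) := by
  have hin : ∀ k < m, ω ∈ alive C k := fun k hk j hj => hlt j (hj.trans_lt hk)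
  have hout : ∀ k, ¬k < m → ω ∉ alive C k := fun k hk h => hm (h m (not_lt.1 hk))
  rw [gainUntilExit, ← Finset.sum_subset (Finset.range_mono hmN)
    fun k _ hk => Set.indicator_of_notMem (hout k (mt Finset.mem_range.2 hk)) _,
    ← Finset.sum_range_sub fun k => v (ω k)]
  exact Finset.sum_congr rfl fun k hk => Set.indicator_of_mem (hin k (Finset.mem_range.1 hk)) _

theorem gainUntilExit_neg (C : Set X) (v : X → ℝ) (N : ℕ) (ω : ℕ → X) :
    gainUntilExit C (-v) N ω = -gainUntilExit C v N ω := by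
  simp only [gainUntilExit, ← Finset.sum_neg_distrib]
  refine Finset.sum_congr rfl fun k _ => ?_
  by_cases h : ω ∈ alive C k
  · simp only [Set.indicator_of_mem h, Pi.neg_apply, neg_sub, neg_sub_neg]
  · simp only [Set.indicator_of_notMem h, neg_zero]

theorem alive_eq_preimage_history (C : Set X) (k : ℕ) :
    alive C k = history k ⁻¹' Set.univ.pi fun _ => C := by
  ext ω
  exact ⟨fun h j _ => h j (Finset.mem_Iic.1 j.2),
    fun h j hj => h ⟨j, Finset.mem_Iic.2 hj⟩ (Set.mem_univ _)⟩

variable [MeasurableSpace X]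

theorem measurable_history (k : ℕ) : Measurable (history (X := X) k) :=
  Preorder.measurable_frestrictLe (X := fun _ => X) k

theorem measurableSet_alive {C : Set X} (hC : MeasurableSet C) (k : ℕ) :
    MeasurableSet (alive C k) := by
  rw [alive_eq_preimage_history]
  exact measurable_history k (MeasurableSet.univ_pi fun _ => hC)

theorem integrable_gainUntilExit {μ : Measure (ℕ → X)} {C : Set X} (hC : MeasurableSet C)
    {v : X → ℝ} (hint : ∀ k, Integrable (fun ω => v (ω k)) μ) (N : ℕ) :
    Integrable (gainUntilExit C v N) μ :=
  integrable_finsetSum _ fun k _ =>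
    ((hint (k + 1)).sub (hint k)).indicator (measurableSet_alive hC k)

variable (κ : (k : ℕ) → Kernel (Finset.Iic k → X) X) [∀ k, IsMarkovKernel (κ k)]
  (x₀ : Finset.Iic 0 → X)

/-- The law of the trajectory with initial history `x₀` and transition kernels `κ`. -/
abbrev trajLaw : Measure (ℕ → X) := Kernel.traj (X := fun _ => X) κ 0 x₀

theorem map_history_succ_trajLaw (k : ℕ) :
    (trajLaw κ x₀).map (fun ω => (history k ω, ω (k + 1))) =
      (trajLaw κ x₀).map (history k) ⊗ₘ κ k := by
  rw [trajLaw, Kernel.traj_map_frestrictLe_apply]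
  exact (Kernel.partialTraj_compProd_eq_map_traj (Nat.zero_le k)).symm

theorem ae_trajLaw_zero [MeasurableSingletonClass (Finset.Iic 0 → X)] :
    ∀ᵐ ω ∂(trajLaw κ x₀), history 0 ω = x₀ := by
  refine (ae_map_iff (measurable_history 0).aemeasurable (measurableSet_singleton x₀)).1 ?_
  rw [Kernel.traj_map_frestrictLe_apply, Kernel.partialTraj_self, Kernel.id_apply]
  exact (ae_dirac_iff (measurableSet_singleton x₀)).2 rfl

theorem ae_trajLaw_succ {k : ℕ} {P : (Finset.Iic k → X) × X → Prop}
    (hP : MeasurableSet {q | P q}) (h : ∀ x, ∀ᵐ y ∂(κ k x), P (x, y)) :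
    ∀ᵐ ω ∂(trajLaw κ x₀), P (history k ω, ω (k + 1)) := by
  refine (ae_map_iff (by fun_prop) hP).1 ?_
  rw [map_history_succ_trajLaw]
  exact (Measure.ae_compProd_iff hP).2 (.of_forall h)

variable {κ x₀}

theorem integrable_compProd_trajLaw {v : X → ℝ} (hv : Measurable v) {k : ℕ}
    (hint : Integrable (fun ω => v (ω (k + 1))) (trajLaw κ x₀)) :
    Integrable (fun q => v q.2) ((trajLaw κ x₀).map (history k) ⊗ₘ κ k) := by
  rw [← map_history_succ_trajLaw]
  exact (integrable_map_measure (hv.comp measurable_snd).aestronglyMeasurable (by fun_prop)).2 hint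

theorem integrable_integral_kernel_map_history {v : X → ℝ} (hv : Measurable v) {k : ℕ}
    (hint : Integrable (fun ω => v (ω (k + 1))) (trajLaw κ x₀)) :
    Integrable (fun h => ∫ y, v y ∂(κ k h)) ((trajLaw κ x₀).map (history k)) :=
  Integrable.integral_compProd (κ := .const Unit _) (η := .prodMkLeft Unit (κ k)) (a := ())
    (integrable_compProd_trajLaw hv hint)

theorem setIntegral_trajLaw_succ {v : X → ℝ} (hv : Measurable v) {k : ℕ}
    (hint : Integrable (fun ω => v (ω (k + 1))) (trajLaw κ x₀)) {B : Set (Finset.Iic k → X)}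
    (hB : MeasurableSet B) :
    ∫ ω in history k ⁻¹' B, v (ω (k + 1)) ∂(trajLaw κ x₀) =
      ∫ ω in history k ⁻¹' B, ∫ y, v y ∂(κ k (history k ω)) ∂(trajLaw κ x₀) := by
  have hmeas : Measurable fun q : (Finset.Iic k → X) × X => v q.2 := hv.comp measurable_snd
  calc ∫ ω in history k ⁻¹' B, v (ω (k + 1)) ∂(trajLaw κ x₀)
      = ∫ q in B ×ˢ Set.univ, v q.2
          ∂((trajLaw κ x₀).map fun ω => (history k ω, ω (k + 1))) := by
        rw [setIntegral_map (hB.prod .univ) hmeas.aestronglyMeasurable (by fun_prop),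
          Set.mk_preimage_prod, Set.preimage_univ, Set.inter_univ]
    _ = ∫ h in B, ∫ y, v y ∂(κ k h) ∂((trajLaw κ x₀).map (history k)) := by
        rw [map_history_succ_trajLaw, Measure.setIntegral_compProd hB .univ
          (integrable_compProd_trajLaw hv hint).integrableOn]
        simp only [Measure.restrict_univ]
    _ = ∫ ω in history k ⁻¹' B, ∫ y, v y ∂(κ k (history k ω)) ∂(trajLaw κ x₀) :=
        setIntegral_map hB (integrable_integral_kernel_map_history hv hint).aestronglyMeasurable
          (measurable_history k).aemeasurable

theorem setIntegral_alive_sub_le {C : Set X} (hC : MeasurableSet C) {v : X → ℝ}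
    (hv : Measurable v) (hint : ∀ k, Integrable (fun ω => v (ω k)) (trajLaw κ x₀)) {c : ℝ}
    (hc : 0 ≤ c) {k : ℕ}
    (hstep : ∀ᵐ ω ∂(trajLaw κ x₀), ω ∈ alive C k →
      ∫ y, v y ∂(κ k (history k ω)) ≤ v (ω k) + c) :
    ∫ ω in alive C k, (v (ω (k + 1)) - v (ω k)) ∂(trajLaw κ x₀) ≤ c := by
  have hkernel : Integrable (fun ω => ∫ y, v y ∂(κ k (history k ω))) (trajLaw κ x₀) :=
    (integrable_integral_kernel_map_history hv (hint (k + 1))).comp_measurable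
      (measurable_history k)
  have hcond : ∫ ω in alive C k, v (ω (k + 1)) ∂(trajLaw κ x₀) =
      ∫ ω in alive C k, ∫ y, v y ∂(κ k (history k ω)) ∂(trajLaw κ x₀) := by
    rw [alive_eq_preimage_history]
    exact setIntegral_trajLaw_succ hv (hint (k + 1)) (.univ_pi fun _ => hC)
  calc ∫ ω in alive C k, (v (ω (k + 1)) - v (ω k)) ∂(trajLaw κ x₀)
      = ∫ ω in alive C k, (∫ y, v y ∂(κ k (history k ω)) - v (ω k)) ∂(trajLaw κ x₀) := by
        rw [integral_sub (hint (k + 1)).integrableOn (hint k).integrableOn, hcond,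
          integral_sub hkernel.integrableOn (hint k).integrableOn]
    _ ≤ ∫ _ in alive C k, c ∂(trajLaw κ x₀) := by
        refine setIntegral_mono_on_ae (hkernel.sub (hint k)).integrableOn
          (integrable_const c).integrableOn (measurableSet_alive hC k) ?_
        filter_upwards [hstep] with ω hω hmem
        linarith [hω hmem]
    _ ≤ c := by
        rw [setIntegral_const, smul_eq_mul]
        exact mul_le_of_le_one_left hc measureReal_le_one

theorem integral_gainUntilExit_le {C : Set X} (hC : MeasurableSet C) {v : X → ℝ}
    (hv : Measurable v) (hint : ∀ k, Integrable (fun ω => v (ω k)) (trajLaw κ x₀)) {c : ℝ}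
    (hc : 0 ≤ c)
    (hstep : ∀ k, ∀ᵐ ω ∂(trajLaw κ x₀), ω ∈ alive C k →
      ∫ y, v y ∂(κ k (history k ω)) ≤ v (ω k) + c) (N : ℕ) :
    ∫ ω, gainUntilExit C v N ω ∂(trajLaw κ x₀) ≤ N * c := by
  calc ∫ ω, gainUntilExit C v N ω ∂(trajLaw κ x₀)
      = ∑ k ∈ Finset.range N, ∫ ω in alive C k, (v (ω (k + 1)) - v (ω k)) ∂(trajLaw κ x₀) := by
        simp only [← integral_indicator (measurableSet_alive hC _)]
        exact integral_finsetSum _ fun k _ =>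
          ((hint (k + 1)).sub (hint k)).indicator (measurableSet_alive hC k)
    _ ≤ ∑ _k ∈ Finset.range N, c :=
        Finset.sum_le_sum fun k _ => setIntegral_alive_sub_le hC hv hint hc (hstep k)
    _ = N * c := by rw [Finset.sum_const, Finset.card_range, nsmul_eq_mul]

end Trajectory

section Play

variable {n : ℕ} {Ω : Set (E n)} {T p ε : ℝ} {z₀ : State n} {ω : ℕ → State n}

/-- A possible course of the game started at `z₀`: every step moves the token by at most `ε` and
lowers the time by `ε²`. -/
structure IsPlay (ε : ℝ) (z₀ : State n) (ω : ℕ → State n) : Prop where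
  start : ω 0 = z₀
  move : ∀ k, (ω (k + 1)).1 ∈ Metric.closedBall (ω k).1 ε
  time_succ : ∀ k, (ω (k + 1)).2 = (ω k).2 - ε ^ 2

namespace IsPlay

theorem time_eq (hω : IsPlay ε z₀ ω) (k : ℕ) : (ω k).2 = z₀.2 - k * ε ^ 2 := by
  induction k with
  | zero => simp [hω.start]
  | succ k ih =>
    rw [hω.time_succ, ih]
    push_cast
    ring

theorem mem_closedBall (hω : IsPlay ε z₀ ω) (k : ℕ) :
    (ω k).1 ∈ Metric.closedBall z₀.1 (k * ε) := by
  induction k with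
  | zero => simp [hω.start]
  | succ k ih =>
    rw [Metric.mem_closedBall] at ih ⊢
    push_cast
    linarith [dist_triangle (ω (k + 1)).1 (ω k).1 z₀.1, Metric.mem_closedBall.1 (hω.move k)]

theorem mem_domain (hω : IsPlay ε z₀ ω) (hz₀ : z₀ ∈ domain Ω T ε) {m : ℕ}
    (hlt : ∀ j < m, ω j ∈ cylinder Ω T) : ω m ∈ domain Ω T ε := by
  cases m with
  | zero => rwa [hω.start]
  | succ j =>
    have hmem := mem_domain_of_dist_le (hlt j j.lt_succ_self) (Metric.mem_closedBall.1 (hω.move j))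
    rwa [← hω.time_succ] at hmem

theorem exists_first_exit (hω : IsPlay ε z₀ ω) (hz₀ : z₀ ∈ domain Ω T ε) {N : ℕ}
    (hN : z₀.2 ≤ N * ε ^ 2) :
    ∃ m ≤ N, ω m ∈ boundaryStrip Ω T ε ∧ ∀ j < m, ω j ∈ cylinder Ω T := by
  classical
  have hN_exit : ω N ∉ cylinder Ω T := fun h => by linarith [h.2.1, hω.time_eq N]
  have hexit : ∃ k, ω k ∉ cylinder Ω T := ⟨N, hN_exit⟩
  have hlt : ∀ j < Nat.find hexit, ω j ∈ cylinder Ω T := fun j hj =>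
    not_not.1 (Nat.find_min hexit hj)
  exact ⟨Nat.find hexit, Nat.find_min' hexit hN_exit,
    (hω.mem_domain hz₀ hlt).resolve_left (Nat.find_spec hexit), hlt⟩

end IsPlay

theorem hitIndex_eq {m : ℕ} (hm : ω m ∈ boundaryStrip Ω T ε) (hlt : ∀ j < m, ω j ∈ cylinder Ω T) :
    hitIndex Ω T ε ω = m := by
  refine le_antisymm (Nat.sInf_le hm) (le_csInf ⟨m, hm⟩ fun k hk => not_lt.1 fun hkm => ?_)
  exact disjoint_cylinder_boundaryStrip.notMem_of_mem_left (hlt k hkm) hk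

theorem IsPlay.payoff_eq (hω : IsPlay ε z₀ ω) {F u : State n → ℝ}
    (hF : Set.EqOn u F (boundaryStrip Ω T ε)) (hz₀ : z₀ ∈ domain Ω T ε) {N : ℕ}
    (hN : z₀.2 ≤ N * ε ^ 2) :
    F (ω (hitIndex Ω T ε ω)) = u z₀ + gainUntilExit (cylinder Ω T) u N ω := by
  obtain ⟨m, hmN, hm, hlt⟩ := hω.exists_first_exit hz₀ hN
  rw [hitIndex_eq hm hlt, ← hF hm, gainUntilExit_eq_sub u
    (disjoint_cylinder_boundaryStrip.notMem_of_mem_right hm) hlt hmN, hω.start,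
    add_sub_cancel]

end Play

section Game

variable {n : ℕ} {Ω : Set (E n)} {T p ε : ℝ} {F u : State n → ℝ}

theorem isProbabilityMeasure_gameLaw (hp : 2 < p) (hε : 0 < ε) (S : Strategy n) (z₀ : State n) :
    IsProbabilityMeasure (gameLaw hp hε S z₀) := by
  have := isMarkovKernel_transition hp hε S
  unfold gameLaw
  infer_instance

theorem ae_isPlay (hp : 2 < p) (hε : 0 < ε) (S : Strategy n) (z₀ : State n) :
    ∀ᵐ ω ∂(gameLaw hp hε S z₀), IsPlay ε z₀ ω := by
  have := isMarkovKernel_transition hp hε S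
  have hstep : ∀ k, ∀ᵐ ω ∂(gameLaw hp hε S z₀),
      (ω (k + 1)).1 ∈ Metric.closedBall (ω k).1 ε ∧ (ω (k + 1)).2 = (ω k).2 - ε ^ 2 := fun k => by
    let last : (Finset.Iic k → State n) → State n := fun h => h ⟨k, Finset.mem_Iic.2 le_rfl⟩
    refine ae_trajLaw_succ (transition p ε S) (fun _ => z₀)
      (P := fun q => q.2.1 ∈ Metric.closedBall (last q.1).1 ε ∧ q.2.2 = (last q.1).2 - ε ^ 2)
      ?_ fun h => ae_stepLaw hε.le (last h) _
    exact (measurableSet_le (by fun_prop) measurable_const).inter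
      (measurableSet_eq_fun (by fun_prop) (by fun_prop))
  filter_upwards [ae_trajLaw_zero (transition p ε S) (fun _ => z₀), ae_all_iff.2 hstep]
    with ω h0 h
  exact ⟨congrFun h0 ⟨0, Finset.mem_Iic.2 le_rfl⟩, fun k => (h k).1, fun k => (h k).2⟩

theorem integrable_comp_eval_gameLaw (hp : 2 < p) (hε : 0 < ε) (S : Strategy n) (z₀ : State n)
    {v : State n → ℝ} (hv : Measurable v) (hb : ∀ t, BoundedOnBounded fun x => v (x, t)) (k : ℕ) :
    Integrable (fun ω => v (ω k)) (gameLaw hp hε S z₀) := by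
  have := isProbabilityMeasure_gameLaw hp hε S z₀
  obtain ⟨M, hM⟩ := hb (z₀.2 - k * ε ^ 2)
    (Metric.isBounded_closedBall (x := z₀.1) (r := k * ε))
  refine .of_bound (hv.comp (measurable_pi_apply k)).aestronglyMeasurable M ?_
  filter_upwards [ae_isPlay hp hε S z₀] with ω hω
  rw [← hω.time_eq k] at hM
  exact hM _ (hω.mem_closedBall k)

theorem expectedPayoff_eq_add_gain (hp : 2 < p) (hε : 0 < ε) (ho : IsOpen Ω) (hm : Measurable u)
    (hb : ∀ t, BoundedOnBounded fun x => u (x, t)) (hF : Set.EqOn u F (boundaryStrip Ω T ε))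
    {z₀ : State n} (hz₀ : z₀ ∈ domain Ω T ε) {N : ℕ} (hN : z₀.2 ≤ N * ε ^ 2) (S : Strategy n) :
    expectedPayoff Ω T hp hε F S z₀ =
      u z₀ + ∫ ω, gainUntilExit (cylinder Ω T) u N ω ∂(gameLaw hp hε S z₀) := by
  have := isProbabilityMeasure_gameLaw hp hε S z₀
  calc expectedPayoff Ω T hp hε F S z₀
      = ∫ ω, (u z₀ + gainUntilExit (cylinder Ω T) u N ω) ∂(gameLaw hp hε S z₀) := by
        refine integral_congr_ae ?_
        filter_upwards [ae_isPlay hp hε S z₀] with ω hω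
        exact hω.payoff_eq hF hz₀ hN
    _ = u z₀ + ∫ ω, gainUntilExit (cylinder Ω T) u N ω ∂(gameLaw hp hε S z₀) := by
        rw [integral_add (integrable_const _) (integrable_gainUntilExit
          (isOpen_cylinder ho).measurableSet (integrable_comp_eval_gameLaw hp hε S z₀ hm hb) N),
          integral_const, probReal_univ, one_smul]

theorem SatisfiesDPP.expectedPayoff_le (hu : SatisfiesDPP Ω T p ε F u) (hp : 2 < p) (hε : 0 < ε)
    (ho : IsOpen Ω) (hm : Measurable u) (hb : ∀ t, BoundedOnBounded fun x => u (x, t))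
    {z₀ : State n} (hz₀ : z₀ ∈ domain Ω T ε) {N : ℕ} (hN : z₀.2 ≤ N * ε ^ 2) (S : Strategy n) :
    expectedPayoff Ω T hp hε F S z₀ ≤ u z₀ := by
  have := isMarkovKernel_transition hp hε S
  have hgain := integral_gainUntilExit_le (κ := transition p ε S) (x₀ := fun _ => z₀)
    (isOpen_cylinder (T := T) ho).measurableSet hm
    (integrable_comp_eval_gameLaw hp hε S z₀ hm hb) le_rfl
    (fun k => .of_forall fun ω hω =>
      (hu.integral_stepLaw_le hm hb hp hε (hω k le_rfl) _).trans_eq (add_zero _).symm) N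
  rw [mul_zero] at hgain
  rw [expectedPayoff_eq_add_gain hp hε ho hm hb hu.boundary hz₀ hN S]
  exact add_le_of_nonpos_right hgain

/-- The strategy that plays the direction `d k x` in the step `k` when the token is at `x`. -/
def markovStrategy (d : ℕ → E n → Metric.sphere (0 : E n) 1) (hd : ∀ k, Measurable (d k)) :
    Strategy n where
  dir k q := d k (q.2 ⟨k, Finset.mem_Iic.2 le_rfl⟩)
  measurable_dir k := (hd k).comp (by fun_prop)

theorem le_expectedPayoff_markovStrategy (hp : 2 < p) (hε : 0 < ε) (ho : IsOpen Ω)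
    (hm : Measurable u) (hb : ∀ t, BoundedOnBounded fun x => u (x, t))
    (hF : Set.EqOn u F (boundaryStrip Ω T ε)) {z₀ : State n} (hz₀ : z₀ ∈ domain Ω T ε) {N : ℕ}
    (hN : z₀.2 ≤ N * ε ^ 2) {δ : ℝ} (hδ : 0 ≤ δ) {d : ℕ → E n → Metric.sphere (0 : E n) 1}
    (hd : ∀ k, Measurable (d k))
    (hopt : ∀ (k : ℕ) x, (x, z₀.2 - k * ε ^ 2) ∈ cylinder Ω T → u (x, z₀.2 - k * ε ^ 2) - δ ≤
      ∫ y, u y ∂(stepLaw p ε (x, z₀.2 - k * ε ^ 2) (d k x))) :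
    u z₀ - N * δ ≤ expectedPayoff Ω T hp hε F (markovStrategy d hd) z₀ := by
  let S := markovStrategy d hd
  have := isMarkovKernel_transition hp hε S
  have hstep : ∀ k, ∀ᵐ ω ∂(gameLaw hp hε S z₀), ω ∈ alive (cylinder Ω T) k →
      ∫ y, (-u) y ∂(transition p ε S k (history k ω)) ≤ (-u) (ω k) + δ := fun k => by
    filter_upwards [ae_isPlay hp hε S z₀] with ω hω hmem
    have hcyl : ω k ∈ cylinder Ω T := hmem k le_rfl
    have hnear := hopt k (ω k).1
    rw [← hω.time_eq k] at hnear
    change ∫ y, -u y ∂(stepLaw p ε (ω k) (d k (ω k).1)) ≤ -u (ω k) + δ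
    rw [integral_neg]
    linarith [hnear hcyl]
  have hgain : -∫ ω, gainUntilExit (cylinder Ω T) u N ω ∂(gameLaw hp hε S z₀) ≤ N * δ := by
    simpa only [gainUntilExit_neg, integral_neg] using!
      integral_gainUntilExit_le (κ := transition p ε S) (x₀ := fun _ => z₀)
        (isOpen_cylinder ho).measurableSet hm.neg
        (fun k => (integrable_comp_eval_gameLaw hp hε S z₀ hm hb k).neg) hδ hstep N
  rw [expectedPayoff_eq_add_gain hp hε ho hm hb hF hz₀ hN S]
  linarith

theorem SatisfiesDPP.eq_gameValue (hu : SatisfiesDPP Ω T p ε F u)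
    (hsupp : Function.support u ⊆ domain Ω T ε) (hn : 1 ≤ n) (ho : IsOpen Ω) (hT : 0 ≤ T)
    (hp : 2 < p) (hε : 0 < ε) (hF : ContinuousOn F (boundaryStrip Ω T ε)) {z : State n}
    (hz : z ∈ domain Ω T ε) : u z = gameValue Ω T hp hε F z := by
  have hm := hu.measurable hsupp ho hT hε.le
  have hslice := hu.slice_regular hsupp hn ho hT hp hε hF
  have hb := fun t => (hslice t).1
  obtain ⟨N, hN⟩ := exists_nat_ge (z.2 / ε ^ 2)
  rw [div_le_iff₀ (by positivity)] at hN
  have hupper := hu.expectedPayoff_le hp hε ho hm hb hz hN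
  have hlower : ∀ δ > 0, ∃ S, u z - N * δ ≤ expectedPayoff Ω T hp hε F S z := fun δ hδ => by
    choose d hd hopt using fun k : ℕ => hu.exists_near_optimal_direction hm
      (hb (z.2 - k * ε ^ 2 - ε ^ 2)) (hslice _).2 hn hp hε hδ
    exact ⟨markovStrategy d hd,
      le_expectedPayoff_markovStrategy hp hε ho hm hb hu.boundary hz hN hδ.le hd hopt⟩
  have : Nonempty (Strategy n) := (hlower 1 one_pos).nonempty
  refine (ciSup_eq_of_forall_le_of_forall_lt_exists_gt hupper fun w hw => ?_).symm
  have hδ : 0 < (u z - w) / (N + 1) := div_pos (sub_pos.2 hw) (by positivity)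
  obtain ⟨S, hS⟩ := hlower _ hδ
  refine ⟨S, lt_of_lt_of_le ?_ hS⟩
  have hsplit : (N + 1) * ((u z - w) / (N + 1)) = u z - w := mul_div_cancel₀ _ (by positivity)
  linarith

end Game

end

end DominativeGame

theorem lemma3p4_general {n : ℕ} (hn : 1 ≤ n) {Ω : Set (DominativeGame.E n)} (hΩ_open : IsOpen Ω)
    {T p ε : ℝ} (hT : 0 < T) (hp : 2 < p) (hε : 0 < ε) {F : DominativeGame.State n → ℝ}
    (hF : ContinuousOn F (DominativeGame.boundaryStrip Ω T ε)) {u : DominativeGame.State n → ℝ}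
    (hu : DominativeGame.SatisfiesDPP Ω T p ε F u) :
    ∀ z ∈ DominativeGame.cylinder Ω T ∪ DominativeGame.boundaryStrip Ω T ε,
      u z = DominativeGame.gameValue Ω T hp hε F z := by
  intro z hz
  rw [← Set.indicator_of_mem hz u]
  exact (hu.indicator_domain hε.le).eq_gameValue Set.support_indicator_subset hn hΩ_open hT.le hp hε
    hF hz

theorem lemma3p4 {n : ℕ} (hn : 1 ≤ n) {Ω : Set (DominativeGame.E n)}
    (hΩ_open : IsOpen Ω) (hΩ_conn : IsConnected Ω) (hΩ_bdd : Bornology.IsBounded Ω)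
    {T p ε : ℝ} (hT : 0 < T) (hp : 2 < p) (hε : 0 < ε)
    {F : DominativeGame.State n → ℝ}
    (hF : ContinuousOn F (DominativeGame.boundaryStrip Ω T ε))
    {u : DominativeGame.State n → ℝ}
    (hu : DominativeGame.SatisfiesDPP Ω T p ε F u) :
    ∀ z ∈ DominativeGame.cylinder Ω T ∪ DominativeGame.boundaryStrip Ω T ε,
      u z = DominativeGame.gameValue Ω T hp hε F z :=
  lemma3p4_general hn hΩ_open hT hp hε hF hu
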